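/- Let $G$ be a connected (simple, possibly infinite, not necessarily locally finite) graph. Then $G$ has weak cop number $1$ if and only if $G$ is quasi-isometric to a tree. Here $d_G$ is the graph distance on $V(G)$, and $G$ is *quasi-isometric* to a graph $T$ if there are a map $h:V(G)\to V(T)$ and constants $C\ge 1$, $D\ge 0$ such that every vertex of $T$ is at distance at most $D$ from $h(V(G))$, and $\frac1C d_G(x,y)-C\le d_T(h(x),h(y))\le C\,d_G(x,y)+C$ for all $x,y\in V(G)$. The weak cop number is defined by the following perfect-information game with parameters $k,s_c,\rho,s_r,R\in\mathbb N$ and a vertex $v$ of $G$. First $k$ cops choose vertices $c_0^1,\dots,c_0^k$, then the robber, knowing these, chooses a vertex $r_0$. In stage $i\ge 1$, every cop $j$ moves to a vertex $c_i^j$ with $d_G(c_{i-1}^j,c_i^j)\le s_c$. If now $d_G(r_{i-1},c_i^j)\le\rho$ for some $j$, the robber is captured; otherwise he moves to a vertex $r_i$ along a path of length at most $s_r$ from $r_{i-1}$ to $r_i$ all of whose vertices are at distance larger than $\rho$ from each of $c_i^1,\dots,c_i^k$. The cops win if the robber is captured or there is $N$ with $d_G(v,r_i)>R$ for all $i\ge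 N$. The graph $G$ is $\mathsf{CopWin}(k,s_c,\rho,s_r,R)$ if for every vertex $v$ the $k$ cops have a winning strategy, and it is *$k$-weak cop win* if there are integers $s_c>0$ and $\rho\ge 0$ such that for all integers $s_r>0$ and $R>0$ the graph $G$ is $\mathsf{CopWin}(k,s_c,\rho,s_r,R)$. The *weak cop number* of $G$ is the infimum of the integers $k\ge 0$ such that $G$ is $k$-weak cop win ($\infty$ if there are none). -/

import Mathlib

universe u w

namespace CoarseCops

/-- `G` is quasi-isometric to `H` (vertex sets with their graph metrics; the graphs are meant to be
connected, so that `SimpleGraph.dist` is the graph metric): there are a map `h` and constants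
`C ≥ 1`, `D ≥ 0` such that every vertex of `H` is at distance at most `D` from the image of `h`, and
`h` distorts distances by at most the multiplicative and additive constant `C`. -/
def QuasiIsometric {V : Type u} {W : Type w} (G : SimpleGraph V) (H : SimpleGraph W) : Prop :=
  ∃ (h : V → W) (C D : ℝ), 1 ≤ C ∧ 0 ≤ D ∧
    (∀ y : W, ∃ x : V, (H.dist y (h x) : ℝ) ≤ D) ∧
    ∀ x y : V,
      (1 / C) * (G.dist x y : ℝ) - C ≤ (H.dist (h x) (h y) : ℝ) ∧
        (H.dist (h x) (h y) : ℝ) ≤ C * (G.dist x y : ℝ) + C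

variable {V : Type u}

/-- A (deterministic, full-information) strategy for `k` cops of speed `sc` on `G`.
`pos [r₀, …, rᵢ₋₁]` is the tuple of positions to which the cops move at stage `i` after having
seen the robber positions `r₀, …, rᵢ₋₁`; `pos []` is the tuple of initial positions, chosen before
the robber appears. The earlier cop positions are determined by the same data, so the robber's
history is the whole history of the game. Every cop travels a distance at most `sc` per stage. -/
structure CopStrategy (G : SimpleGraph V) (k sc : ℕ) where
  /-- the positions of the cops as a function of the robber's history -/
  pos : List V → Fin k → V
  /-- each cop moves to a vertex at distance at most `sc` -/
  legal : ∀ (l : List V) (x : V) (j : Fin k), G.dist (pos l j) (pos (l ++ [x]) j) ≤ sc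

/-- The positions of the cops after their move of stage `i` (the initial ones for `i = 0`), when they
follow `σ` and the robber's positions are `r 0, r 1, …`. -/
def CopStrategy.copsAt {G : SimpleGraph V} {k sc : ℕ} (σ : CopStrategy G k sc) (r : ℕ → V) (i : ℕ) :
    Fin k → V :=
  σ.pos ((List.range i).map r)

/-- With the cops at `c`, with reach `ρ`, a robber of speed `sr` can move from `x` to `y`: there is a
path of length at most `sr` from `x` to `y` all of whose vertices (ends included) are at distance
larger than `ρ` from every cop. -/
def RobberMove (G : SimpleGraph V) {k : ℕ} (c : Fin k → V) (ρ sr : ℕ) (x y : V) : Prop :=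
  ∃ p : G.Walk x y, p.IsPath ∧ p.length ≤ sr ∧ ∀ z ∈ p.support, ∀ j : Fin k, ρ < G.dist z (c j)

/-- The robber is captured during stage `i + 1`: after the cops' move of that stage, some cop is at
distance at most `ρ` from the robber, who is still at `r i`. -/
def CapturedAt {G : SimpleGraph V} {k sc : ℕ} (σ : CopStrategy G k sc) (ρ : ℕ) (r : ℕ → V)
    (i : ℕ) : Prop :=
  ∃ j : Fin k, G.dist (r i) (σ.copsAt r (i + 1) j) ≤ ρ

/-- `r` records a play of the robber against `σ`: `r 0` is arbitrary, and at each stage `i + 1`, as long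
as the robber has not been captured during that stage or before, he makes an allowed move from
`r i` to `r (i + 1)`. The terms of `r` after a capture are irrelevant. -/
def IsRobberPlay {G : SimpleGraph V} {k sc : ℕ} (σ : CopStrategy G k sc) (ρ sr : ℕ)
    (r : ℕ → V) : Prop :=
  ∀ i : ℕ, (∀ m ≤ i, ¬ CapturedAt σ ρ r m) →
    RobberMove G (σ.copsAt r (i + 1)) ρ sr (r i) (r (i + 1))

/-- `k` cops with speed `sc` and reach `ρ` can eventually protect the ball of radius `R` centered at `v`
against a robber of speed `sr`: they have a strategy such that, however the robber plays, he is
captured or from some time on stays at distance larger than `R` from `v`. -/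
def CanProtect (G : SimpleGraph V) (k sc ρ sr R : ℕ) (v : V) : Prop :=
  ∃ σ : CopStrategy G k sc, ∀ r : ℕ → V, IsRobberPlay σ ρ sr r →
    (∃ i, CapturedAt σ ρ r i) ∨ ∃ N : ℕ, ∀ i ≥ N, R < G.dist v (r i)

/-- `G` is `CopWin (k, sc, ρ, sr, R)`. -/
def CopWin (G : SimpleGraph V) (k sc ρ sr R : ℕ) : Prop :=
  ∀ v : V, CanProtect G k sc ρ sr R v

/-- `G` is `k`-weak cop win: the cops choose their speed and reach, and then win whatever speed and
radius the robber chooses. -/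
def WeakCopWin (G : SimpleGraph V) (k : ℕ) : Prop :=
  ∃ sc ρ : ℕ, 0 < sc ∧ ∀ sr R : ℕ, 0 < sr → 0 < R → CopWin G k sc ρ sr R

/-- The weak cop number: the infimum of the `k` such that `G` is `k`-weak cop win (`⊤` if there are
none). -/
noncomputable def weakCopNumber (G : SimpleGraph V) : ℕ∞ :=
  ⨅ (k : ℕ) (_ : WeakCopWin G k), (k : ℕ∞)

end CoarseCops

/-! The link between the game and trees is a bottleneck property: every walk joining the ends of a
geodesic passes near each of its vertices. If a tree models the graph, a cop shadows a tree cop who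
steps each turn towards the robber's image. The robber cannot jump past the shadow, so he is caught
or pushed ever deeper (`weakCopWin_one_of_quasiIsometric`). Conversely, a geodesic avoided near `m`
by some walk gives a large loop through `m` on which one cop cannot stop a fast robber from
returning to a fixed ball (`WeakCopWin.hasBottlenecks`). Bottlenecks bound the layer classes around
a root, and these classes form a tree (`HasBottlenecks.exists_tree`). -/

namespace CoarseCops

open SimpleGraph

/-! ### Pursuit in a tree -/

/-- Every walk from the root `o` to `z` passes through `t`. -/
def Separates {W : Type w} (T : SimpleGraph W) (o t z : W) : Prop :=
  ∀ p : T.Walk o z, t ∈ p.support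

lemma mem_support_dist_add {V : Type u} {G : SimpleGraph V} {x y z : V} (p : G.Walk x y)
    (hp : p.length = G.dist x y) (hG : G.Connected) (hz : z ∈ p.support) :
    G.dist x z + G.dist z y = G.dist x y := by
  classical
  have h1 := congrArg Walk.length (p.take_spec hz)
  rw [Walk.length_append] at h1
  have h2 := dist_le (p.takeUntil z hz)
  have h3 := dist_le (p.dropUntil z hz)
  have h4 := hG.dist_triangle (u := x) (v := z) (w := y)
  omega

lemma dist_le_length_of_mem_support {V : Type u} {G : SimpleGraph V} {x y z : V} (p : G.Walk x y)
    (hz : z ∈ p.support) : G.dist x z ≤ p.length := by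
  classical
  exact (dist_le (p.takeUntil z hz)).trans (p.length_takeUntil_le_length hz)

namespace Separates

variable {W : Type w} {T : SimpleGraph W} {o t z : W}

lemma refl_left (z : W) : Separates T o o z := fun p => p.start_mem_support

lemma dist_le (hT : T.Connected) (h : Separates T o t z) : T.dist o t ≤ T.dist o z := by
  obtain ⟨p, hp⟩ := hT.exists_walk_length_eq_dist o z
  have := mem_support_dist_add p hp hT (h p)
  omega

/-- A geodesic from `z` to `z'` is too short to meet `t`, so appending it cannot create the passage
through `t`. -/
lemma of_dist_lt (hT : T.Connected) {z' : W} (h : Separates T o t z)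
    (hd : T.dist z z' < T.dist z t) : Separates T o t z' := by
  intro p
  obtain ⟨q, hq⟩ := hT.exists_walk_length_eq_dist z z'
  rcases (Walk.mem_support_append_iff p q.reverse).1 (h (p.append q.reverse)) with h1 | h1
  · exact h1
  · rw [Walk.support_reverse, List.mem_reverse] at h1
    have := dist_le_length_of_mem_support q h1
    omega

lemma exists_child (hT : T.IsTree) (h : Separates T o t z) (hne : t ≠ z) :
    ∃ t', T.dist t t' ≤ 1 ∧ Separates T o t' z ∧ T.dist o t' = T.dist o t + 1 := by
  classical
  obtain ⟨p, hp, hlen⟩ := hT.connected.exists_path_of_dist o z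
  have hmem := h p
  have hspec := p.take_spec hmem
  cases hq : p.dropUntil t hmem with
  | nil => exact absurd rfl hne
  | @cons _ t' _ hadj q =>
    have hsub : t' ∈ p.support := by
      rw [← hspec, Walk.mem_support_append_iff, hq]
      right
      simp
    have hone : T.dist t t' = 1 := dist_eq_one_iff_adj.2 hadj
    refine ⟨t', hone.le, fun w => ?_, ?_⟩
    · have : w.bypass = p := (hT.existsUnique_path o z).unique w.bypass_isPath hp
      exact w.support_bypass_subset_support (this ▸ hsub)
    · have h1 := congrArg Walk.length hspec
      rw [Walk.length_append, hq, Walk.length_cons, hlen] at h1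
      have h2 := SimpleGraph.dist_le (p.takeUntil t hmem)
      have h3 := SimpleGraph.dist_le q
      have h4 := hT.connected.dist_triangle (u := o) (v := t) (w := t')
      have h5 := hT.connected.dist_triangle (u := o) (v := t') (w := z)
      omega

end Separates

lemma exists_descend {W : Type w} {T : SimpleGraph W} (hT : T.IsTree) (o : W) :
    ∃ step : W → W → W, ∀ t z, T.dist t (step t z) ≤ 1 ∧
      (Separates T o t z → t ≠ z →
        Separates T o (step t z) z ∧ T.dist o (step t z) = T.dist o t + 1) := by
  have : ∀ t z, ∃ t', T.dist t t' ≤ 1 ∧ (Separates T o t z → t ≠ z →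
      Separates T o t' z ∧ T.dist o t' = T.dist o t + 1) := by
    intro t z
    by_cases h : Separates T o t z ∧ t ≠ z
    · obtain ⟨t', h1, h2⟩ := h.1.exists_child hT h.2
      exact ⟨t', h1, fun _ _ => h2⟩
    -- Staying put otherwise keeps the strategy legal on every history.
    · exact ⟨t, by simp, fun h1 h2 => absurd ⟨h1, h2⟩ h⟩
  choose step hstep using this
  exact ⟨step, hstep⟩

/-- A cop in a graph which is quasi-isometric to a tree shadows a cop of the tree, who keeps
descending towards the image of the robber. -/
theorem weakCopWin_one_of_quasiIsometric {V : Type u} {W : Type w} {G : SimpleGraph V}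
    {T : SimpleGraph W} (hT : T.IsTree) (hqi : QuasiIsometric G T) : WeakCopWin G 1 := by
  obtain ⟨h, C, D, hC, hD, hsurj, hdist⟩ := hqi
  choose g hg using hsurj
  have hC0 : 0 < C := by linarith
  have tri : ∀ a b c : W, (T.dist a c : ℝ) ≤ T.dist a b + T.dist b c := fun a b c => by
    exact_mod_cast hT.connected.dist_triangle
  have lower : ∀ x y : V, (G.dist x y : ℝ) ≤ C * (T.dist (h x) (h y) + C) := fun x y => by
    have h1 := (hdist x y).1
    have h2 : (1 / C) * (G.dist x y : ℝ) ≤ T.dist (h x) (h y) + C := by linarith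
    rw [one_div_mul_eq_div, div_le_iff₀ hC0] at h2
    linarith
  -- Speed: lifts of tree vertices at distance at most 1 have images at most `2 * D + 1` apart.
  -- Reach: escaping `g s` forces the image to be more than `2 * C` from `s`, while an edge of `G`
  -- moves images by at most `2 * C`.
  refine ⟨⌈C * (2 * D + 1 + C)⌉₊ + 1, ⌈C * (4 * C + D)⌉₊, Nat.succ_pos _, ?_⟩
  intro sr R _ _ v
  obtain ⟨step, hstep⟩ := exists_descend hT (h v)
  let shadow : List V → W := fun l => l.foldl (fun t x => step t (h x)) (h v)
  have shadow_snoc : ∀ l x, shadow (l ++ [x]) = step (shadow l) (h x) := fun l x => by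
    simp [shadow]
  refine ⟨⟨fun l _ => g (shadow l), ?_⟩, ?_⟩
  · intro l x _
    have h1 : (T.dist (shadow l) (shadow (l ++ [x])) : ℝ) ≤ 1 := by
      rw [shadow_snoc]
      exact_mod_cast (hstep _ _).1
    have h2 := tri (h (g (shadow l))) (shadow l) (h (g (shadow (l ++ [x]))))
    have h3 := tri (shadow l) (shadow (l ++ [x])) (h (g (shadow (l ++ [x]))))
    have h4 := hg (shadow l)
    rw [dist_comm] at h4
    have h5 := hg (shadow (l ++ [x]))
    have h6 := lower (g (shadow l)) (g (shadow (l ++ [x])))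
    have h7 : C * ((T.dist (h (g (shadow l))) (h (g (shadow (l ++ [x])))) : ℝ) + C)
        ≤ C * (2 * D + 1 + C) := mul_le_mul_of_nonneg_left (by linarith) hC0.le
    have h8 := Nat.le_ceil (C * (2 * D + 1 + C))
    have h9 : (G.dist (g (shadow l)) (g (shadow (l ++ [x]))) : ℝ)
        ≤ (⌈C * (2 * D + 1 + C)⌉₊ : ℕ) := by linarith
    exact (Nat.cast_le.1 h9).trans (Nat.le_succ _)
  · intro r hr
    rw [or_iff_not_imp_left]
    intro hcap
    rw [not_exists] at hcap
    let t : ℕ → W := fun i => shadow ((List.range i).map r)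
    have t_succ : ∀ i, t (i + 1) = step (t i) (h (r i)) := fun i => by
      simp only [t, List.range_succ, List.map_append, List.map_cons, List.map_nil]
      exact shadow_snoc _ _
    have far : ∀ (z : V) (s : W), ⌈C * (4 * C + D)⌉₊ < G.dist z (g s) →
        2 * C < T.dist (h z) s := fun z s hz => by
      have h1 := lower z (g s)
      have h2 := Nat.lt_of_ceil_lt hz
      have h3 : 4 * C + D < T.dist (h z) (h (g s)) + C :=
        lt_of_mul_lt_mul_left (h2.trans_le h1) hC0.le
      have h4 := tri (h z) s (h (g s))
      have h5 := hg s
      linarith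
    have hnear : ∀ x y : V, G.Adj x y → (T.dist (h x) (h y) : ℝ) ≤ 2 * C := fun x y hxy => by
      have h1 := (hdist x y).2
      rw [dist_eq_one_iff_adj.2 hxy] at h1
      push_cast at h1
      linarith
    have along : ∀ (s : W) (x y : V) (p : G.Walk x y),
        (∀ z ∈ p.support, ⌈C * (4 * C + D)⌉₊ < G.dist z (g s)) →
        Separates T (h v) s (h x) → Separates T (h v) s (h y) := by
      intro s x y p
      induction p with
      | nil => exact fun _ hx => hx
      | @cons a b c hab p ih =>
        intro hp hx
        refine ih (fun z hz => hp z (by simp [hz])) (hx.of_dist_lt hT.connected ?_)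
        have h1 := far a s (hp a (by simp))
        have h2 := hnear a b hab
        exact_mod_cast h2.trans_lt h1
    have inv : ∀ i, Separates T (h v) (t i) (h (r i)) ∧ T.dist (h v) (t i) = i := by
      intro i
      induction i with
      | zero => exact ⟨Separates.refl_left _, by simp [t, shadow]⟩
      | succ i ih =>
        have hnc : ⌈C * (4 * C + D)⌉₊ < G.dist (r i) (g (t (i + 1))) := by
          have := hcap i
          simp only [CapturedAt, not_exists, not_le] at this
          exact this 0
        have h1 := far _ _ hnc
        -- Otherwise the shadow, after its step, would be within 1 of the robber's image, hence a
        -- capture.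
        have hne : t i ≠ h (r i) := by
          intro he
          have h2 := (hstep (t i) (h (r i))).1
          rw [← t_succ, he] at h2
          have : (T.dist (h (r i)) (t (i + 1)) : ℝ) ≤ 1 := by exact_mod_cast h2
          linarith
        have h3 := (hstep (t i) (h (r i))).2 ih.1 hne
        rw [← t_succ] at h3
        obtain ⟨p, _, _, hp⟩ := hr i (fun m _ => hcap m)
        exact ⟨along _ _ _ p (fun z hz => hp z hz 0) h3.1, by rw [h3.2, ih.2]⟩
    refine ⟨⌈C * (R + 1)⌉₊ + 1, fun i hi => ?_⟩
    have h1 := (inv i).1.dist_le hT.connected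
    rw [(inv i).2] at h1
    have h2 : (i : ℝ) ≤ T.dist (h v) (h (r i)) := by exact_mod_cast h1
    have h3 := (hdist v (r i)).2
    have h4 : C * (R + 1) < i := Nat.lt_of_ceil_lt hi
    have h5 : C * (R + 1 : ℝ) < C * (G.dist v (r i) + 1) := by linarith
    have h6 := lt_of_mul_lt_mul_left h5 hC0.le
    have h7 : (R : ℝ) < G.dist v (r i) := by linarith
    exact_mod_cast h7

/-! ### Bottlenecks and the evading robber -/

/-- Every walk between the ends of a geodesic comes within distance `Δ` of each vertex of the
geodesic. -/
def HasBottlenecks {V : Type u} (G : SimpleGraph V) (Δ : ℕ) : Prop :=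
  ∀ x y m : V, G.dist x m + G.dist m y = G.dist x y →
    ∀ p : G.Walk x y, ∃ z ∈ p.support, G.dist m z ≤ Δ

theorem not_weakCopWin_zero {V : Type u} [Nonempty V] (G : SimpleGraph V) :
    ¬ WeakCopWin G 0 := by
  rintro ⟨sc, ρ, -, hwin⟩
  obtain ⟨v⟩ := ‹Nonempty V›
  obtain ⟨σ, hσ⟩ := hwin 1 1 one_pos one_pos v
  rcases hσ (fun _ => v) (fun i _ => ⟨Walk.nil, by simp, by simp, fun z _ j => j.elim0⟩) with
    ⟨i, j, -⟩ | ⟨N, hN⟩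
  · exact j.elim0
  · simpa using hN N le_rfl

/-- A robber whose `i`-th position is a function `f` of the position of the cops at stage `i`. -/
lemma exists_positional_play {V : Type u} {G : SimpleGraph V} {k sc : ℕ} (σ : CopStrategy G k sc)
    (f : (Fin k → V) → V) : ∃ r : ℕ → V, ∀ i, r i = f (σ.copsAt r i) := by
  let hist : ℕ → List V := fun n => Nat.rec [] (fun _ l => l ++ [f (σ.pos l)]) n
  refine ⟨fun n => f (σ.pos (hist n)), fun i => ?_⟩
  have : ∀ n, (List.range n).map (fun n => f (σ.pos (hist n))) = hist n := by
    intro n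
    induction n with
    | zero => rfl
    | succ n ih => rw [List.range_succ, List.map_append, ih]; rfl
  simp only [CopStrategy.copsAt, this]

/-- If a geodesic has no bottleneck at `m`, the robber evades a cop by commuting between `m` and an
end of the geodesic. -/
theorem WeakCopWin.hasBottlenecks {V : Type u} {G : SimpleGraph V} (hG : G.Connected)
    (hwin : WeakCopWin G 1) : ∃ Δ, HasBottlenecks G Δ := by
  classical
  obtain ⟨sc, ρ, -, hwin⟩ := hwin
  refine ⟨3 * ρ + 2 * sc, fun x y m hm p => ?_⟩
  by_contra! hp
  obtain ⟨p₁, hp₁⟩ := hG.exists_walk_length_eq_dist x m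
  obtain ⟨p₂, hp₂⟩ := hG.exists_walk_length_eq_dist m y
  have tri : ∀ a b c, G.dist a c ≤ G.dist a b + G.dist b c := fun a b c => hG.dist_triangle
  obtain ⟨σ, hσ⟩ := hwin (p₁.length + p.length + p₂.length + 1) (G.dist m x + 1)
    (Nat.succ_pos _) (Nat.succ_pos _) m
  -- The margin `sc` absorbs the cop's next move, so waiting at `m` is safe, and whenever the robber
  -- changes ends the cop is between `2 * ρ` and `2 * ρ + 2 * sc` from `m`.
  let target : V → V := fun c => if G.dist c m ≤ 2 * ρ + sc then x else m
  obtain ⟨r, hr⟩ := exists_positional_play σ (fun c => target (c 0))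
  have hcop : ∀ i, G.dist (σ.copsAt r i 0) (σ.copsAt r (i + 1) 0) ≤ sc := fun i => by
    have := σ.legal ((List.range i).map r) (r i) 0
    simpa [CopStrategy.copsAt, List.range_succ] using this
  have hsafe : ∀ c c', G.dist c c' ≤ sc → ρ < G.dist (target c) c' := by
    intro c c' hcc
    by_cases hc : G.dist c m ≤ 2 * ρ + sc
    · simp only [target, hc, if_true]
      have h1 := hp x p.start_mem_support
      have h2 := tri m c x
      have h3 := tri c c' x
      have h4 := G.dist_comm (u := c) (v := m)
      have h5 := G.dist_comm (u := c') (v := x)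
      omega
    · simp only [target, hc, if_false]
      have h2 := tri c c' m
      have h5 := G.dist_comm (u := c') (v := m)
      omega
  have hfree : ∀ i, ¬ CapturedAt σ ρ r i := by
    rintro i ⟨j, hj⟩
    rw [Subsingleton.elim j 0, hr i] at hj
    exact absurd hj (not_le.2 (hsafe _ _ (hcop i)))
  have hwalk : ∀ c, 2 * ρ < G.dist c m → G.dist c m ≤ 2 * ρ + 2 * sc →
      ∃ q : G.Walk x m, q.length ≤ p₁.length + p.length + p₂.length ∧
        ∀ z ∈ q.support, ρ < G.dist z c := by
    intro c hc hc'
    by_cases h1 : ∀ z ∈ p₁.support, ρ < G.dist z c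
    · exact ⟨p₁, by omega, h1⟩
    push Not at h1
    obtain ⟨a, ha, hac⟩ := h1
    -- The cop blocks `p₁`, so the robber goes around. `p` is too far from `m` to be blocked; a cop
    -- within `ρ` of both `a` on `p₁` and `z` on `p₂` would, as `x`, `m`, `y` lie on a geodesic, be
    -- within `2 * ρ` of `m`.
    refine ⟨p.append p₂.reverse, by simp, fun z hz => ?_⟩
    rcases (Walk.mem_support_append_iff _ _).1 hz with hz | hz
    · have h1 := hp z hz
      have h2 := tri m c z
      have h3 := G.dist_comm (u := c) (v := m)
      have h4 := G.dist_comm (u := c) (v := z)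
      omega
    · rw [Walk.support_reverse, List.mem_reverse] at hz
      have h1 := mem_support_dist_add p₁ hp₁ hG ha
      have h2 := mem_support_dist_add p₂ hp₂ hG hz
      have h3 := tri x a y
      have h4 := tri a z y
      have h5 := tri a c z
      have h6 := tri c a m
      have h7 := tri c z m
      have h8 := G.dist_comm (u := c) (v := a)
      have h9 := G.dist_comm (u := c) (v := z)
      have h10 := G.dist_comm (u := z) (v := m)
      omega
  have hmove : ∀ c c' : Fin 1 → V, G.dist (c 0) (c' 0) ≤ sc →
      RobberMove G c' ρ (p₁.length + p.length + p₂.length + 1) (target (c 0))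
        (target (c' 0)) := by
    intro c c' hcc
    have of_walk : ∀ a b (q : G.Walk a b), q.length ≤ p₁.length + p.length + p₂.length →
        (∀ z ∈ q.support, ρ < G.dist z (c' 0)) →
        RobberMove G c' ρ (p₁.length + p.length + p₂.length + 1) a b := by
      intro a b q hq hz
      refine ⟨q.bypass, q.bypass_isPath, ?_, fun z hz' j => ?_⟩
      · have := q.length_bypass_le_length
        omega
      · rw [Subsingleton.elim j 0]
        exact hz z (q.support_bypass_subset_support hz')
    have hs := hsafe _ _ hcc
    have h1 := tri (c 0) (c' 0) m
    have h2 := tri (c' 0) (c 0) m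
    have h3 := G.dist_comm (u := c 0) (v := c' 0)
    by_cases hc : G.dist (c 0) m ≤ 2 * ρ + sc <;> by_cases hc' : G.dist (c' 0) m ≤ 2 * ρ + sc <;>
      simp only [target, hc, hc', if_true, if_false] at hs ⊢
    · exact of_walk _ _ Walk.nil (by simp) (by simpa using hs)
    · obtain ⟨q, hq, hz⟩ := hwalk (c' 0) (by omega) (by omega)
      exact of_walk _ _ q hq hz
    · obtain ⟨q, hq, hz⟩ := hwalk (c' 0) (by omega) (by omega)
      exact of_walk _ _ q.reverse (by simpa using hq) (by simpa using hz)
    · exact of_walk _ _ Walk.nil (by simp) (by simpa using hs)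
  rcases hσ r (fun i _ => by rw [hr i, hr (i + 1)]; exact hmove _ _ (hcop i)) with
    ⟨i, hi⟩ | ⟨N, hN⟩
  · exact hfree i hi
  · have h1 := hN N le_rfl
    rw [hr N] at h1
    simp only [target] at h1
    split_ifs at h1
    · omega
    · simp at h1

/-! ### The layering tree -/

/-- The graph joining each point to its parent, when all points descend from a single root, is a
tree. -/
theorem isTree_fromRel_parent {W : Type w} (par : W → W) (depth : W → ℕ) (root : W)
    (hpar : ∀ a, a ≠ root → depth (par a) < depth a) (hroot : par root = root) :
    (SimpleGraph.fromRel fun a b => par a = b).IsTree := by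
  have hle : ∀ a, depth (par a) ≤ depth a := fun a => by
    by_cases h : a = root
    · rw [h, hroot]
    · exact (hpar a h).le
  have hiter : ∀ k a, depth (par^[k] a) ≤ depth a := by
    intro k
    induction k with
    | zero => exact fun a => le_rfl
    | succ k ih => exact fun a => (ih (par a)).trans (hle a)
  have bridge : ∀ a, a ≠ par a →
      (SimpleGraph.fromRel fun a b => par a = b).IsBridge s(a, par a) := by
    intro a ha
    -- Without this edge, no walk leaves the descendants of `a`; by depth, `par a` is not among
    -- them.
    have hstay : ∀ x y, ((SimpleGraph.fromRel fun a b => par a = b).deleteEdges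
        {s(a, par a)}).Walk x y → (∃ k, par^[k] x = a) → ∃ k, par^[k] y = a := by
      intro x y p
      induction p with
      | nil => exact id
      | @cons x z y hxz p ih =>
        rintro ⟨k, hk⟩
        refine ih ?_
        rw [deleteEdges_adj, fromRel_adj, Set.mem_singleton_iff] at hxz
        obtain ⟨⟨-, hxz | hxz⟩, hne⟩ := hxz
        · cases k with
          | zero =>
            obtain rfl : x = a := hk
            exact absurd (by rw [hxz]) hne
          | succ k => exact ⟨k, by rw [← hxz]; exact hk⟩
        · exact ⟨k + 1, by rw [Function.iterate_succ_apply, hxz]; exact hk⟩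
    rw [isBridge_iff]
    rintro ⟨p⟩
    obtain ⟨k, hk⟩ := hstay _ _ p ⟨0, rfl⟩
    have h1 := hiter k (par a)
    rw [hk] at h1
    have h2 : a ≠ root := by
      rintro rfl
      exact ha hroot.symm
    exact absurd (hpar a h2) (not_lt.2 h1)
  have hreach : ∀ n a, depth a = n →
      (SimpleGraph.fromRel fun a b => par a = b).Reachable a root := by
    intro n
    induction n using Nat.strong_induction_on with
    | _ n ih =>
      intro a ha
      by_cases h : a = root
      · rw [h]
      · have hlt := hpar a h
        have hne : a ≠ par a := fun he => by rw [← he] at hlt; exact lt_irrefl _ hlt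
        have hadj : (SimpleGraph.fromRel fun a b => par a = b).Adj a (par a) :=
          ⟨hne, Or.inl rfl⟩
        exact hadj.reachable.trans (ih _ (ha ▸ hlt) _ rfl)
  have : Nonempty W := ⟨root⟩
  refine ⟨⟨fun a b => (hreach _ a rfl).trans (hreach _ b rfl).symm⟩, ?_⟩
  rw [isAcyclic_iff_forall_adj_isBridge]
  intro a b hab
  obtain ⟨hne, rfl | rfl⟩ := (fromRel_adj _ _ _).1 hab
  · exact bridge a hne
  · rw [Sym2.eq_swap]
    exact bridge b hne.symm

variable {V : Type u} {G : SimpleGraph V}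

lemma exists_dist_eq_on_geodesic (hG : G.Connected) (o x : V) {k : ℕ} (hk : k ≤ G.dist o x) :
    ∃ m, G.dist o m = k ∧ G.dist o m + G.dist m x = G.dist o x := by
  obtain ⟨p, hp⟩ := hG.exists_walk_length_eq_dist o x
  refine ⟨p.getVert k, ?_, mem_support_dist_add p hp hG (p.getVert_mem_support k)⟩
  have h1 := dist_le (p.take k)
  have h2 := dist_le (p.drop k)
  have h3 := mem_support_dist_add p hp hG (p.getVert_mem_support k)
  rw [Walk.take_length] at h1
  rw [Walk.drop_length] at h2
  omega

/-- Two vertices lie in the same component of a sphere around `o`, in the complement of the open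
ball bounded by this sphere. -/
def SameLayer (G : SimpleGraph V) (o x y : V) : Prop :=
  G.dist o x = G.dist o y ∧ ∃ p : G.Walk x y, ∀ z ∈ p.support, G.dist o x ≤ G.dist o z

lemma SameLayer.symm {o x y : V} (h : SameLayer G o x y) : SameLayer G o y x := by
  obtain ⟨h1, p, hp⟩ := h
  exact ⟨h1.symm, p.reverse, by simpa [← h1] using hp⟩

lemma SameLayer.trans {o x y z : V} (h : SameLayer G o x y) (h' : SameLayer G o y z) :
    SameLayer G o x z := by
  obtain ⟨h1, p, hp⟩ := h
  obtain ⟨h2, q, hq⟩ := h'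
  refine ⟨h1.trans h2, p.append q, fun v hv => ?_⟩
  rcases (Walk.mem_support_append_iff _ _).1 hv with hv | hv
  · exact hp v hv
  · exact h1 ▸ hq v hv

/-- The equivalence relation whose classes are the vertices of the layering tree. -/
def layerSetoid (G : SimpleGraph V) (o : V) : Setoid V where
  r := SameLayer G o
  iseqv := ⟨fun x => ⟨rfl, Walk.nil, by simp⟩, SameLayer.symm, SameLayer.trans⟩

lemma SameLayer.dist_le {o x y : V} {Δ : ℕ} (hG : G.Connected) (hΔ : HasBottlenecks G Δ)
    (h : SameLayer G o x y) : G.dist x y ≤ 4 * Δ + 2 := by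
  obtain ⟨hd, p, hp⟩ := h
  have tri : ∀ a b c, G.dist a c ≤ G.dist a b + G.dist b c := fun a b c => hG.dist_triangle
  by_cases hn : G.dist o x ≤ Δ
  · have h1 := tri x o y
    have h2 := G.dist_comm (u := x) (v := o)
    omega
  -- At `Δ + 1` below the layer, the ball of radius `Δ` around `m` misses `p`, so the bottleneck
  -- falls on the geodesic to `y`, at most `2 * Δ + 1` from `y`.
  obtain ⟨m, hm, hmx⟩ := exists_dist_eq_on_geodesic hG o x (k := G.dist o x - (Δ + 1)) (by omega)
  obtain ⟨q, hq⟩ := hG.exists_walk_length_eq_dist o y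
  obtain ⟨z, hz, hmz⟩ := hΔ o x m hmx (q.append p.reverse)
  have h1 := tri o m z
  rcases (Walk.mem_support_append_iff _ _).1 hz with hz | hz
  · have h2 := mem_support_dist_add q hq hG hz
    have h3 := tri o z m
    have h4 := tri x m y
    have h5 := tri m z y
    have h6 := G.dist_comm (u := x) (v := m)
    have h7 := G.dist_comm (u := z) (v := m)
    omega
  · rw [Walk.support_reverse, List.mem_reverse] at hz
    have h2 := hp z hz
    omega

lemma exists_pred (hG : G.Connected) (o : V) :
    ∃ pred : V → V, pred o = o ∧
      ∀ x, x ≠ o → G.Adj (pred x) x ∧ G.dist o x = G.dist o (pred x) + 1 := by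
  classical
  have : ∀ x, ∃ x', x ≠ o → G.Adj x' x ∧ G.dist o x = G.dist o x' + 1 := by
    intro x
    by_cases hx : x = o
    · exact ⟨x, fun h => absurd hx h⟩
    have hpos := hG.pos_dist_of_ne (Ne.symm hx)
    obtain ⟨m, h1, h2⟩ := exists_dist_eq_on_geodesic hG o x (k := G.dist o x - 1) (by omega)
    exact ⟨m, fun _ => ⟨dist_eq_one_iff_adj.1 (by omega), by omega⟩⟩
  choose f hf using this
  refine ⟨fun x => if x = o then o else f x, by simp, fun x hx => ?_⟩
  simpa [hx] using hf x hx

/-- This makes the parent of a class independent of the representative and of the chosen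
predecessor. -/
lemma SameLayer.of_adj {o x y x' y' : V} (h : SameLayer G o x y) (hx : G.Adj x' x)
    (hy : G.Adj y' y) (hdx : G.dist o x = G.dist o x' + 1) (hdy : G.dist o y = G.dist o y' + 1) :
    SameLayer G o x' y' := by
  obtain ⟨h1, p, hp⟩ := h
  refine ⟨by omega, Walk.cons hx (p.concat hy.symm), fun z hz => ?_⟩
  simp only [Walk.support_cons, Walk.support_concat, List.mem_cons,
    List.mem_append, List.not_mem_nil, or_false] at hz
  rcases hz with rfl | hz | rfl
  · exact le_rfl
  · have := hp z hz
    omega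
  · omega

/-- A graph with bottlenecks is quasi-isometric to its layering tree. -/
theorem HasBottlenecks.exists_tree {Δ : ℕ} (hG : G.Connected) (hΔ : HasBottlenecks G Δ) :
    ∃ (W : Type u) (T : SimpleGraph W), T.IsTree ∧ QuasiIsometric G T := by
  obtain ⟨o⟩ := hG.nonempty
  obtain ⟨pred, hpo, hpred⟩ := exists_pred hG o
  have dist_zero : ∀ x, G.dist o x = 0 → x = o := fun x hx => (hG.dist_eq_zero_iff.1 hx).symm
  have pred_congr : ∀ x y, SameLayer G o x y → SameLayer G o (pred x) (pred y) := by
    intro x y h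
    by_cases hx : x = o
    · have hy : y = o := dist_zero y (by rw [← h.1, hx, dist_self])
      rw [hx, hy]
      exact (layerSetoid G o).refl _
    · have hy : y ≠ o := by
        rintro rfl
        exact hx (dist_zero x (by rw [h.1, dist_self]))
      exact h.of_adj (hpred x hx).1 (hpred y hy).1 (hpred x hx).2 (hpred y hy).2
  let cls : V → Quotient (layerSetoid G o) := Quotient.mk _
  let par : Quotient (layerSetoid G o) → Quotient (layerSetoid G o) :=
    Quotient.map pred pred_congr
  let depth : Quotient (layerSetoid G o) → ℕ := Quotient.lift (G.dist o) fun _ _ h => h.1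
  have hT := isTree_fromRel_parent par depth (cls o)
    (by
      intro a
      induction a using Quotient.inductionOn with
      | _ x =>
        intro ha
        have hx : x ≠ o := by
          rintro rfl
          exact ha rfl
        have := (hpred x hx).2
        change G.dist o (pred x) < G.dist o x
        omega)
    (by change cls (pred o) = cls o; rw [hpo])
  set T := SimpleGraph.fromRel fun a b => par a = b
  have cls_eq : ∀ {x y}, SameLayer G o x y → cls x = cls y := fun h => Quotient.sound h
  have of_cls_eq : ∀ {x y}, cls x = cls y → SameLayer G o x y := fun h => Quotient.exact h
  have par_edge : ∀ a, T.dist a (par a) ≤ 1 := by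
    intro a
    by_cases h : a = par a
    · rw [← h]; simp
    · exact (dist_eq_one_iff_adj.2 (show T.Adj a (par a) from ⟨h, Or.inl rfl⟩)).le
  have up : ∀ x y, G.Adj x y → G.dist o y = G.dist o x + 1 → par (cls y) = cls x := by
    intro x y hxy hd
    have hy : y ≠ o := by
      rintro rfl
      simp at hd
    exact cls_eq (((layerSetoid G o).refl y : SameLayer G o y y).of_adj (hpred y hy).1 hxy
      (hpred y hy).2 hd)
  have edge : ∀ x y, G.Adj x y → T.dist (cls x) (cls y) ≤ 1 := by
    intro x y hxy
    have h1 := dist_eq_one_iff_adj.2 hxy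
    have h2 := hG.dist_triangle (u := o) (v := x) (w := y)
    have h3 := hG.dist_triangle (u := o) (v := y) (w := x)
    rw [G.dist_comm (u := y) (v := x)] at h3
    obtain h | h | h : G.dist o x = G.dist o y ∨ G.dist o y = G.dist o x + 1 ∨
      G.dist o x = G.dist o y + 1 := by omega
    · have hs : SameLayer G o x y := ⟨h, Walk.cons hxy Walk.nil, by simp [h]⟩
      rw [cls_eq hs]; simp
    · rw [← up x y hxy h, T.dist_comm]
      exact par_edge _
    · rw [← up y x hxy.symm h]
      exact par_edge _
  have upper_walk : ∀ x y (p : G.Walk x y), T.dist (cls x) (cls y) ≤ p.length := by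
    intro x y p
    induction p with
    | nil => simp
    | @cons x z y hxz p ih =>
      have h1 := edge x z hxz
      have h2 := hT.connected.dist_triangle (u := cls x) (v := cls z) (w := cls y)
      rw [Walk.length_cons]
      omega
  have pred_dist : ∀ x, G.dist x (pred x) ≤ 1 := by
    intro x
    by_cases hx : x = o
    · rw [hx, hpo]; simp
    · exact (dist_eq_one_iff_adj.2 (hpred x hx).1.symm).le
  -- Each tree edge lifts to one edge of `G` plus at most one jump of length `4 * Δ + 2` inside a
  -- class.
  have lower_walk : ∀ a b (q : T.Walk a b) x y, cls x = a → cls y = b →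
      G.dist x y ≤ (4 * Δ + 3) * q.length + (4 * Δ + 3) := by
    intro a b q
    induction q with
    | nil =>
      intro x y hx hy
      have := (of_cls_eq (hx.trans hy.symm)).dist_le hG hΔ
      rw [Walk.length_nil]
      omega
    | @cons a b c hab q ih =>
      intro x y hx hy
      obtain ⟨z, hz⟩ : ∃ z, cls z = b := Quotient.exists_rep b
      rw [Walk.length_cons, mul_add, mul_one]
      obtain h | h := ((fromRel_adj _ _ _).1 hab).2
      · have h1 := ih (pred x) y (by rw [← h, ← hx]; rfl) hy
        have h2 := pred_dist x
        have h3 := hG.dist_triangle (u := x) (v := pred x) (w := y)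
        omega
      · have h0 : cls (pred z) = cls x := by rw [hx, ← h, ← hz]; rfl
        have h1 := ih z y hz hy
        have h2 := pred_dist z
        have h3 := hG.dist_triangle (u := x) (v := z) (w := y)
        have h4 := hG.dist_triangle (u := x) (v := pred z) (w := z)
        have h5 := (of_cls_eq h0.symm).dist_le hG hΔ
        rw [G.dist_comm] at h2
        omega
  refine ⟨_, T, hT, cls, 4 * Δ + 3, 0, ?_, le_rfl, ?_, fun x y => ⟨?_, ?_⟩⟩
  · have : (0 : ℝ) ≤ Δ := Nat.cast_nonneg _
    linarith
  · intro a
    obtain ⟨x, rfl⟩ : ∃ x, cls x = a := Quotient.exists_rep a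
    exact ⟨x, by simp⟩
  · obtain ⟨q, hq⟩ := hT.connected.exists_walk_length_eq_dist (cls x) (cls y)
    have h1 := lower_walk _ _ q x y rfl rfl
    rw [hq] at h1
    have h2 : (G.dist x y : ℝ) ≤ (4 * Δ + 3) * T.dist (cls x) (cls y) + (4 * Δ + 3) := by
      exact_mod_cast h1
    have h3 : (0 : ℝ) ≤ Δ := Nat.cast_nonneg _
    have h4 : (0 : ℝ) < 4 * Δ + 3 := by linarith
    rw [one_div_mul_eq_div, sub_le_iff_le_add, div_le_iff₀ h4]
    nlinarith
  · obtain ⟨p, hp⟩ := hG.exists_walk_length_eq_dist x y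
    have h1 := upper_walk x y p
    rw [hp] at h1
    have h2 : (T.dist (cls x) (cls y) : ℝ) ≤ G.dist x y := by exact_mod_cast h1
    have h3 : (0 : ℝ) ≤ Δ := Nat.cast_nonneg _
    have h4 : (0 : ℝ) ≤ G.dist x y := Nat.cast_nonneg _
    nlinarith

/-- Zero cops never win, so the infimum is 1 exactly when it is attained there; no monotonicity in
the number of cops is needed. -/
theorem weakCopNumber_eq_one_iff [Nonempty V] : weakCopNumber G = 1 ↔ WeakCopWin G 1 := by
  constructor
  · intro h
    by_contra hne
    have h2 : (2 : ℕ∞) ≤ weakCopNumber G := by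
      refine le_iInf₂ fun k hk => ?_
      have h0 : k ≠ 0 := by
        rintro rfl
        exact not_weakCopWin_zero G hk
      have h1 : k ≠ 1 := by
        rintro rfl
        exact hne hk
      exact_mod_cast (show 2 ≤ k by omega)
    rw [h] at h2
    exact absurd h2 (by decide)
  · intro h
    refine le_antisymm ((iInf₂_le 1 h).trans (by simp)) (le_iInf₂ fun k hk => ?_)
    have h0 : k ≠ 0 := by
      rintro rfl
      exact not_weakCopWin_zero G hk
    exact_mod_cast Nat.one_le_iff_ne_zero.2 h0

end CoarseCops

theorem corollary5p3 {V : Type u} (G : SimpleGraph V) (hG : G.Connected) :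
    CoarseCops.weakCopNumber G = 1 ↔
      ∃ (W : Type u) (T : SimpleGraph W), T.IsTree ∧ CoarseCops.QuasiIsometric G T := by
  have := hG.nonempty
  rw [CoarseCops.weakCopNumber_eq_one_iff]
  constructor
  · intro h
    obtain ⟨Δ, hΔ⟩ := h.hasBottlenecks hG
    exact hΔ.exists_tree hG
  · rintro ⟨W, T, hT, hqi⟩
    exact CoarseCops.weakCopWin_one_of_quasiIsometric hT hqi
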